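/- In the dispersion process with $M$ particles on a finite graph $G$, all $M$ particles are initially placed at one vertex of $G$ (the origin). The process is synchronous: at each step, every particle that shares its vertex with at least one other particle at the beginning of the step moves to a neighbour of that vertex chosen uniformly at random, all these choices being independent, and every particle that is alone at its vertex stays. The dispersion time $T_{\mathrm{Disp}}\in\{0,1,2,\dots\}\cup\{\infty\}$ is the number of steps until, for the first time, every vertex holds at most one particle. Theorem. Let $\delta>0$ be a constant. Let $G$ be the complete graph $K_n$ or the star $S_n$ on $n\ge 1$ vertices, and let the origin be any vertex of $G$. (i) There are constants $A,B>0$ depending only on $\delta$ such that, for every $n$, every such $G$ and origin and every number of particles $M$ with $M/n\le \frac12(1-\delta)$, $$\Pr\bigl(T_{\mathrm{Disp}}\le A\log n\bigr)\ \ge\ 1-\frac{B}{n}.$$ (ii) There is a constant $c=c(\delta)>0$ such that, for every $n$, every such $G$ and origin and every number of particles $M$ with $\frac12(1+\delta)\le M/n<1$, $$\Pr\bigl(T_{\mathrm{Disp}}\le e^{cn}\bigr)\ <\ e^{-cn}.$$ -/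

import Mathlib

open MeasureTheory
open scoped ENNReal

noncomputable section

namespace Dispersion

open Classical in
/-- One step of simple random walk on `G` from `v`: a uniformly random neighbour of `v`.
(On a vertex without neighbours the walk stays put.) -/
def neighborPMF {V : Type*} [Fintype V] (G : SimpleGraph V) (v : V) : PMF V :=
  if h : (G.neighborFinset v).Nonempty then PMF.uniformOfFinset (G.neighborFinset v) h
  else PMF.pure v

/-- The source of randomness for `M` particles on the vertex set `V`: `ξ t (i, v)` is the vertex to
which particle `i` moves at step `t + 1` if it has to move at that step and is located at `v`. -/
abbrev Choices (V : Type*) (M : ℕ) : Type _ := ℕ → (Fin M × V → V)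

/-- All the choices `ξ t (i, v)` are independent, and `ξ t (i, v)` is a uniformly random
neighbour of `v`. -/
def choiceMeasure {V : Type*} [Fintype V] [MeasurableSpace V] (G : SimpleGraph V) (M : ℕ) :
    Measure (Choices V M) :=
  Measure.infinitePi fun _ : ℕ =>
    Measure.pi fun q : Fin M × V => (neighborPMF G q.2).toMeasure

instance {V : Type*} [Fintype V] [MeasurableSpace V] (G : SimpleGraph V) (M : ℕ) :
    IsProbabilityMeasure (choiceMeasure G M) := by
  unfold choiceMeasure; infer_instance

open Classical in
/-- One synchronous step from the configuration `x` (`x i` is the location of particle `i`):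
every particle that shares its vertex with another particle moves, all others stay. -/
def step {V : Type*} {M : ℕ} (x : Fin M → V) (ξ : Fin M × V → V) : Fin M → V :=
  fun i => if ∃ j, j ≠ i ∧ x j = x i then ξ (i, x i) else x i

/-- The configuration after `t` steps, with all particles started at the vertex `o`. -/
def config {V : Type*} {M : ℕ} (o : V) (ω : Choices V M) : ℕ → Fin M → V
  | 0 => fun _ => o
  | t + 1 => step (config o ω t) (ω t)

/-- A configuration is dispersed if every vertex holds at most one particle. -/
def Dispersed {V : Type*} {M : ℕ} (x : Fin M → V) : Prop :=
  ∀ v : V, {i : Fin M | x i = v}.ncard ≤ 1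

/-- The dispersion time: the first `t` at which the configuration is dispersed
(`⊤` if there is none). -/
def dispersionTime {V : Type*} {M : ℕ} (o : V) (ω : Choices V M) : ℕ∞ :=
  ⨅ (t : ℕ) (_ : Dispersed (config o ω t)), (t : ℕ∞)

/-- The probability that `M` particles started at the vertex `o` of `G` have dispersion time at
most the real number `r ≥ 0`. -/
def probDispersedWithin {V : Type*} [Fintype V] [MeasurableSpace V] (G : SimpleGraph V) (M : ℕ)
    (o : V) (r : ℝ) : ℝ :=
  (choiceMeasure G M).real {ω | (dispersionTime o ω : ℝ≥0∞) ≤ ENNReal.ofReal r}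

end Dispersion

end

/-! ### Resampling one coordinate of a product measure. -/

open MeasureTheory
open scoped ENNReal

/-! Call a particle unsettled if it shares its vertex, and let `u` be the number of unsettled
particles. Suppose that every unsettled particle is at a vertex adjacent to all others, so that each
destination is uniform on `n - 1` vertices.

Below density 1/2, a first moment argument suffices. A pair of particles with at least one mover
collides with probability at most `1/(n-1)`, and at most `2(M-1)u` ordered pairs contain a mover.
Hence `E u` shrinks by the factor `2(M-1)/(n-1) ≤ 1-δ` (`integral_card_unsettled_step_le`); after
order `log n` steps it is `O(1/n)`, and Markov's inequality concludes.

Above density 1/2, `u` rarely falls below a small multiple `k` of `n`. Choose `k` movers and reveal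
their destinations one by one. As long as few particles are unsettled, more than half of the
vertices hold a settled particle, so each revealed mover hits one with probability at least `p >
1/2` and then unsettles two particles. On average this exceeds one per mover, and an exponential
moment bounds the probability of ending below `k` by `ρ ^ k` with `ρ < 1`
(`integral_unsettled_lt_le`). A union bound over `e^{cn}` steps finishes for large `n`; for small
`n` only the first step matters.

On the star, movers are alternately all at the centre, where the above applies, and all at leaves,
from where they jump together to the empty centre and the unsettled set is unchanged. `FullPhases`
treats both graphs at once, at the price of counting steps in pairs. -/

theorem measurePreserving_update_infinitePi {ι : Type*} [DecidableEq ι] {X : ι → Type*}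
    [∀ i, MeasurableSpace (X i)] (μ : ∀ i, Measure (X i)) [∀ i, IsProbabilityMeasure (μ i)]
    (i : ι) :
    MeasurePreserving (fun p : (∀ j, X j) × X i => Function.update p.1 i p.2)
      ((Measure.infinitePi μ).prod (μ i)) (Measure.infinitePi μ) := by
  have hm : Measurable (fun p : (∀ j, X j) × X i => Function.update p.1 i p.2) := by
    refine measurable_pi_lambda _ fun j => ?_
    rcases eq_or_ne j i with rfl | h
    · simpa using measurable_snd
    · simp only [Function.update_of_ne h]
      exact (measurable_pi_apply j).comp measurable_fst
  refine ⟨hm, Measure.eq_infinitePi μ fun s t ht => ?_⟩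
  have hms : MeasurableSet (Set.pi (s : Set ι) t) :=
    MeasurableSet.pi s.countable_toSet fun j _ => ht j
  rw [Measure.map_apply hm hms]
  by_cases his : i ∈ s
  · have h : (fun p : (∀ j, X j) × X i => Function.update p.1 i p.2) ⁻¹' Set.pi (s : Set ι) t
        = Set.pi ((s.erase i : Finset ι) : Set ι) t ×ˢ t i := by
      ext p
      simp only [Set.mem_preimage, Set.mem_pi, Finset.mem_coe, Set.mem_prod, Finset.mem_erase]
      constructor
      · intro h
        refine ⟨fun j hj => by simpa [hj.1] using h j hj.2, by simpa using h i his⟩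
      · rintro ⟨h₁, h₂⟩ j hj
        rcases eq_or_ne j i with rfl | hji
        · simpa using h₂
        · simpa [hji] using h₁ j ⟨hji, hj⟩
    rw [h, Measure.prod_prod, Measure.infinitePi_pi _ fun j _ => ht j,
      Finset.prod_erase_mul _ _ his]
  · have h : (fun p : (∀ j, X j) × X i => Function.update p.1 i p.2) ⁻¹' Set.pi (s : Set ι) t
        = Set.pi (s : Set ι) t ×ˢ Set.univ := by
      ext p
      simp only [Set.mem_preimage, Set.mem_pi, Finset.mem_coe, Set.mem_prod, Set.mem_univ, and_true]
      refine forall₂_congr fun j hj => ?_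
      have : j ≠ i := fun h => his (h ▸ hj)
      simp [this]
    rw [h, Measure.prod_prod, Measure.infinitePi_pi _ fun j _ => ht j, measure_univ, mul_one]

/-- This replaces conditional expectation: freeze all coordinates but one and integrate that one
out. It is applied to a time coordinate for the Markov property and to a single particle's choice
within a step. -/
theorem integral_infinitePi_update {ι : Type*} [DecidableEq ι] {X : ι → Type*}
    [∀ i, MeasurableSpace (X i)] (μ : ∀ i, Measure (X i)) [∀ i, IsProbabilityMeasure (μ i)]
    (i : ι) {f : (∀ j, X j) → ℝ} (hf : Integrable f (Measure.infinitePi μ)) :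
    ∫ ω, f ω ∂Measure.infinitePi μ
      = ∫ ω, ∫ w, f (Function.update ω i w) ∂μ i ∂Measure.infinitePi μ := by
  have h := measurePreserving_update_infinitePi μ i
  have hf' := h.integrable_comp_of_integrable hf
  have h₁ := integral_map h.aemeasurable (f := f)
    (by rw [h.map_eq]; exact hf.aestronglyMeasurable)
  rw [h.map_eq] at h₁
  exact h₁.trans (integral_prod _ hf')

/-! ### Markov property and the law of a single jump. -/

namespace Dispersion

theorem config_update {V : Type*} {M : ℕ} (o : V) (ω : Choices V M) (t : ℕ) (ξ : Fin M × V → V) {s : ℕ} (hs : s ≤ t) :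
    config o (Function.update ω t ξ) s = config o ω s := by
  induction s with
  | zero => rfl
  | succ s ih =>
    have : s ≠ t := by omega
    simp [config, ih (by omega), this]

section Walk

variable {V : Type*} [Fintype V] [MeasurableSpace V]

/-- The law of the choices used in a single step. -/
noncomputable abbrev stepMeasure (G : SimpleGraph V) (M : ℕ) : Measure (Fin M × V → V) :=
  Measure.pi fun q : Fin M × V => (neighborPMF G q.2).toMeasure

variable [MeasurableSingletonClass V]

theorem integral_stepMeasure_update [DecidableEq V] (G : SimpleGraph V) (M : ℕ) (q : Fin M × V)
    (f : (Fin M × V → V) → ℝ) :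
    ∫ ξ, f ξ ∂stepMeasure G M
      = ∫ ξ, ∫ w, f (Function.update ξ q w) ∂(neighborPMF G q.2).toMeasure ∂stepMeasure G M := by
  have h := integral_infinitePi_update (fun q : Fin M × V => (neighborPMF G q.2).toMeasure) q
    (f := f) (by rw [Measure.infinitePi_eq_pi]; exact Integrable.of_finite)
  rwa [Measure.infinitePi_eq_pi] at h

variable {M : ℕ}

theorem measurable_config (o : V) (t : ℕ) : Measurable fun ω : Choices V M => config o ω t := by
  induction t with
  | zero => exact measurable_const
  | succ t ih =>
    have h : Measurable fun p : (Fin M → V) × (Fin M × V → V) => step p.1 p.2 :=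
      Measurable.of_discrete
    exact h.comp (ih.prodMk (measurable_pi_apply t))

theorem integrable_config (G : SimpleGraph V) (o : V) (t : ℕ) (f : (Fin M → V) → ℝ) :
    Integrable (fun ω => f (config o ω t)) (choiceMeasure G M) := by
  have hf : Integrable f ((choiceMeasure G M).map fun ω => config o ω t) := by
    have := Measure.isProbabilityMeasure_map (μ := choiceMeasure G M)
      (measurable_config (M := M) o t).aemeasurable
    exact Integrable.of_finite
  exact hf.comp_measurable (measurable_config o t)

/-- The Markov property of the sequence of configurations. -/
theorem integral_config_succ (G : SimpleGraph V) (o : V) (t : ℕ) (f : (Fin M → V) → ℝ) :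
    ∫ ω, f (config o ω (t + 1)) ∂choiceMeasure G M
      = ∫ ω, ∫ ξ, f (step (config o ω t) ξ) ∂stepMeasure G M ∂choiceMeasure G M := by
  have h := integral_infinitePi_update (fun _ : ℕ => stepMeasure G M) t
    (integrable_config G o (t + 1) f)
  refine h.trans (integral_congr_ae (.of_forall fun ω => ?_))
  simp [config, config_update]

theorem toMeasure_neighborPMF_real [DecidableEq V] (G : SimpleGraph V) (v : V)
    (hG : ∀ w, w ≠ v → G.Adj v w) (hV : 1 < Fintype.card V) (T : Finset V) :
    (neighborPMF G v).toMeasure.real T = (T.erase v).card / ((Fintype.card V : ℝ) - 1) := by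
  classical
  have hN : G.neighborFinset v = Finset.univ.erase v := by
    ext w
    simp only [SimpleGraph.mem_neighborFinset, Finset.mem_erase, Finset.mem_univ, and_true]
    exact ⟨fun h => h.ne', hG w⟩
  have hc : (G.neighborFinset v).card = Fintype.card V - 1 := by
    rw [hN, Finset.card_erase_of_mem (Finset.mem_univ _), Finset.card_univ]
  have hne : (G.neighborFinset v).Nonempty := Finset.card_pos.mp (by omega)
  rw [neighborPMF, dif_pos (by convert hne), Measure.real, PMF.toMeasure_uniformOfFinset_apply _ _ T.measurableSet,
    ENNReal.toReal_div]
  congr 1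
  · rw [ENNReal.toReal_natCast]
    congr 2
    ext w
    simp only [Finset.mem_filter, SimpleGraph.mem_neighborFinset, Finset.mem_coe,
      Finset.mem_erase]
    exact ⟨fun h => ⟨h.1.ne', h.2⟩, fun h => ⟨hG w h.1, h.2⟩⟩
  · have : (G.neighborFinset v).card = Fintype.card V - 1 := hc
    rw [ENNReal.toReal_natCast]
    have h2 : ((Fintype.card V - 1 : ℕ) : ℝ) = (Fintype.card V : ℝ) - 1 := by
      rw [Nat.cast_sub hV.le, Nat.cast_one]
    rw [← h2, ← this]

theorem ae_adj (G : SimpleGraph V) (M : ℕ) :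
    ∀ᵐ ω ∂choiceMeasure G M, ∀ t i v, (∃ w, G.Adj v w) → G.Adj v (ω t (i, v)) := by
  classical
  simp only [ae_all_iff]
  intro t i v hv
  have h1 : ∀ᵐ w ∂(neighborPMF G v).toMeasure, G.Adj v w := by
    obtain ⟨w, hw⟩ := hv
    rw [ae_iff, PMF.toMeasure_apply_eq_zero_iff _ (Set.toFinite _).measurableSet,
      Set.disjoint_left]
    intro u hu
    have hn : (G.neighborFinset v).Nonempty := ⟨w, by simpa using hw⟩
    unfold neighborPMF at hu
    rw [dif_pos (by convert hn), PMF.mem_support_uniformOfFinset_iff] at hu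
    simpa using hu
  have h2 : ∀ᵐ ξ ∂stepMeasure G M, G.Adj v (ξ (i, v)) :=
    (measurePreserving_eval (fun q : Fin M × V => (neighborPMF G q.2).toMeasure)
      (i, v)).quasiMeasurePreserving.ae h1
  exact (measurePreserving_eval_infinitePi (fun _ : ℕ => stepMeasure G M)
    t).quasiMeasurePreserving.ae h2

end Walk

end Dispersion

/-! ### Unsettled particles and one-step estimates. -/

namespace Dispersion

open Classical in
/-- The particles of `S` that share their vertex with another particle of `S`. -/
noncomputable def unsettled {V : Type*} {M : ℕ} (S : Finset (Fin M)) (x : Fin M → V) :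
    Finset (Fin M) :=
  {i ∈ S | ∃ j ∈ S, j ≠ i ∧ x j = x i}

section Combinatorics

variable {V : Type*} {M : ℕ} {S T : Finset (Fin M)} {x z : Fin M → V} {i j : Fin M}

theorem mem_unsettled : i ∈ unsettled S x ↔ i ∈ S ∧ ∃ j ∈ S, j ≠ i ∧ x j = x i := by
  simp [unsettled]

theorem mem_unsettled_univ : i ∈ unsettled Finset.univ x ↔ ∃ j, j ≠ i ∧ x j = x i := by
  simp [unsettled]

theorem unsettled_subset (S : Finset (Fin M)) (x : Fin M → V) : unsettled S x ⊆ S :=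
  fun _ h => (mem_unsettled.mp h).1

theorem unsettled_mono (h : S ⊆ T) (x : Fin M → V) : unsettled S x ⊆ unsettled T x := by
  intro i hi
  obtain ⟨hi, j, hj, h'⟩ := mem_unsettled.mp hi
  exact mem_unsettled.mpr ⟨h hi, j, h hj, h'⟩

theorem unsettled_congr (h : ∀ i ∈ S, x i = z i) : unsettled S x = unsettled S z := by
  ext i
  simp only [mem_unsettled]
  refine and_congr_right fun hi => exists_congr fun j => and_congr_right fun hj => ?_
  rw [h i hi, h j hj]

theorem injOn_sdiff_unsettled (S : Finset (Fin M)) (x : Fin M → V) :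
    Set.InjOn x ↑(S \ unsettled S x) := by
  intro i hi j hj hij
  by_contra hne
  rw [Finset.mem_coe, Finset.mem_sdiff] at hi hj
  exact hi.2 (mem_unsettled.mpr ⟨hi.1, j, hj.1, fun h => hne h.symm, hij.symm⟩)

/-- Both the newcomer and the settled particle it lands on become unsettled. This gain of two makes
1/2 the critical density. -/
theorem card_unsettled_insert (hi : i ∉ S) (hj : j ∈ S) (hju : j ∉ unsettled S x)
    (hij : x j = x i) : (unsettled S x).card + 2 ≤ (unsettled (insert i S) x).card := by
  classical
  have hne : i ≠ j := fun h => hi (h ▸ hj)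
  have hsub : insert i (insert j (unsettled S x)) ⊆ unsettled (insert i S) x := by
    intro l hl
    rcases Finset.mem_insert.mp hl with rfl | hl
    · exact mem_unsettled.mpr ⟨Finset.mem_insert_self _ _, j, Finset.mem_insert_of_mem hj,
        hne.symm, hij⟩
    rcases Finset.mem_insert.mp hl with rfl | hl
    · exact mem_unsettled.mpr ⟨Finset.mem_insert_of_mem hj, i, Finset.mem_insert_self _ _,
        hne, hij.symm⟩
    · exact unsettled_mono (Finset.subset_insert _ _) x hl
  have hiu : i ∉ insert j (unsettled S x) := by
    simp only [Finset.mem_insert, not_or]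
    exact ⟨hne, fun h => hi (unsettled_subset _ _ h)⟩
  have := Finset.card_le_card hsub
  rwa [Finset.card_insert_of_notMem hiu, Finset.card_insert_of_notMem hju] at this

theorem card_unsettled_le_sum (x : Fin M → V) [DecidableEq V] :
    ((unsettled Finset.univ x).card : ℝ)
      ≤ ∑ p ∈ (Finset.univ : Finset (Fin M)).offDiag, if x p.1 = x p.2 then (1 : ℝ) else 0 := by
  rw [Finset.sum_boole]
  norm_cast
  refine Finset.card_le_card_of_surjOn Prod.fst fun i hi => ?_
  obtain ⟨j, hji, hj⟩ := mem_unsettled_univ.mp hi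
  exact ⟨(i, j), by simp [hji.symm, hj], rfl⟩

theorem dispersed_iff : Dispersed x ↔ unsettled Finset.univ x = ∅ := by
  constructor
  · intro h
    rw [Finset.eq_empty_iff_forall_notMem]
    intro i hi
    obtain ⟨j, hji, hj⟩ := mem_unsettled_univ.mp hi
    exact hji ((Set.ncard_le_one (Set.toFinite _)).mp (h (x i)) j hj i rfl)
  · intro h v
    refine (Set.ncard_le_one (Set.toFinite _)).mpr fun j hj i hi => ?_
    by_contra hne
    have : i ∈ unsettled Finset.univ x :=
      mem_unsettled_univ.mpr ⟨j, hne, Eq.trans hj (Eq.symm hi)⟩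
    simp [h] at this

theorem step_of_mem (ξ : Fin M × V → V) (hi : i ∈ unsettled Finset.univ x) :
    step x ξ i = ξ (i, x i) :=
  if_pos (mem_unsettled_univ.mp hi)

theorem step_of_notMem (ξ : Fin M × V → V) (hi : i ∉ unsettled Finset.univ x) :
    step x ξ i = x i :=
  if_neg fun h => hi (mem_unsettled_univ.mpr h)

theorem step_of_unsettled_eq_empty (ξ : Fin M × V → V) (h : unsettled Finset.univ x = ∅) :
    step x ξ = x :=
  funext fun _ => step_of_notMem ξ (by simp [h])

theorem step_update [DecidableEq V] (ξ : Fin M × V → V) (hi : i ∈ unsettled Finset.univ x)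
    (w : V) : step x (Function.update ξ (i, x i) w) = Function.update (step x ξ) i w := by
  funext j
  rcases eq_or_ne j i with rfl | hji
  · simp [step_of_mem _ hi]
  · have hq : (j, x j) ≠ (i, x i) := fun h => hji (congrArg Prod.fst h)
    rw [Function.update_of_ne hji]
    by_cases hj : j ∈ unsettled Finset.univ x
    · rw [step_of_mem _ hj, step_of_mem _ hj, Function.update_of_ne hq]
    · rw [step_of_notMem _ hj, step_of_notMem _ hj]

end Combinatorics

section OneStep

variable {V : Type*} [Fintype V] [MeasurableSpace V] [MeasurableSingletonClass V]
  {G : SimpleGraph V} {M : ℕ} {x : Fin M → V}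

theorem integral_mem_neighborPMF [DecidableEq V] (v : V) (T : Finset V) :
    ∫ w, (if w ∈ T then (1 : ℝ) else 0) ∂(neighborPMF G v).toMeasure
      = (neighborPMF G v).toMeasure.real T := by
  have h : (fun w => if w ∈ T then (1 : ℝ) else 0) = (T : Set V).indicator 1 := by
    funext w
    simp [Set.indicator_apply]
  rw [h, integral_indicator_one T.measurableSet]

/-- Resampling only the choice of the mover `i` leaves the new position of `j` fixed, so `i` must
hit one prescribed vertex. -/
theorem integral_collision_le [DecidableEq V] (hV : 1 < Fintype.card V) {i j : Fin M}
    (hi : i ∈ unsettled Finset.univ x) (hG : ∀ w, w ≠ x i → G.Adj (x i) w) (hij : i ≠ j) :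
    ∫ ξ, (if step x ξ i = step x ξ j then (1 : ℝ) else 0) ∂stepMeasure G M
      ≤ 1 / ((Fintype.card V : ℝ) - 1) := by
  have hn : (0 : ℝ) < (Fintype.card V : ℝ) - 1 := by
    rw [sub_pos]; exact_mod_cast hV
  rw [integral_stepMeasure_update G M (i, x i)]
  have h : ∀ ξ : Fin M × V → V, ∫ w, (if step x (Function.update ξ (i, x i) w) i
      = step x (Function.update ξ (i, x i) w) j then (1 : ℝ) else 0)
        ∂(neighborPMF G (x i)).toMeasure ≤ 1 / ((Fintype.card V : ℝ) - 1) := by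
    intro ξ
    have := integral_mem_neighborPMF (G := G) (x i) {step x ξ j}
    rw [toMeasure_neighborPMF_real G (x i) hG hV] at this
    simp only [step_update ξ hi, Function.update_self, Function.update_of_ne hij.symm]
    simp only [Finset.mem_singleton] at this
    rw [this]
    gcongr
    exact_mod_cast (Finset.card_erase_le.trans_eq (Finset.card_singleton _))
  refine (integral_mono Integrable.of_finite (integrable_const _) h).trans ?_
  simp

theorem integral_card_unsettled_step_le [DecidableEq V] (hV : 1 < Fintype.card V)
    (hG : ∀ i ∈ unsettled Finset.univ x, ∀ w, w ≠ x i → G.Adj (x i) w) :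
    ∫ ξ, ((unsettled Finset.univ (step x ξ)).card : ℝ) ∂stepMeasure G M
      ≤ 2 * ((M : ℝ) - 1) / ((Fintype.card V : ℝ) - 1) * (unsettled Finset.univ x).card := by
  set a : ℝ := 1 / ((Fintype.card V : ℝ) - 1) with ha
  set u := unsettled Finset.univ x with hu
  have hn : (0 : ℝ) < (Fintype.card V : ℝ) - 1 := by
    rw [sub_pos]; exact_mod_cast hV
  have ha0 : 0 ≤ a := by positivity
  have hpair : ∀ p ∈ (Finset.univ : Finset (Fin M)).offDiag,
      ∫ ξ, (if step x ξ p.1 = step x ξ p.2 then (1 : ℝ) else 0) ∂stepMeasure G M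
        ≤ a * ((if p.1 ∈ u then 1 else 0) + (if p.2 ∈ u then 1 else 0)) := by
    rintro ⟨i, j⟩ hp
    have hij : i ≠ j := by simpa using hp
    by_cases hi : i ∈ u
    · refine (integral_collision_le hV hi (hG i hi) hij).trans ?_
      rw [← ha]
      have : (0 : ℝ) ≤ if j ∈ u then 1 else 0 := by split_ifs <;> norm_num
      rw [if_pos hi]
      nlinarith
    · by_cases hj : j ∈ u
      · have := integral_collision_le hV hj (hG j hj) hij.symm
        simp only [eq_comm (a := step x _ j)] at this
        simpa [hi, hj, ha] using this
      · have hne : x i ≠ x j := fun h => hi (mem_unsettled_univ.mpr ⟨j, hij.symm, h.symm⟩)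
        simp [step_of_notMem _ hi, step_of_notMem _ hj, hi, hj, hne]
  -- Each of the two indicators sums to `M * #u` over all pairs, of which the diagonal accounts for
  -- `#u`.
  have hsum : ∑ p ∈ (Finset.univ : Finset (Fin M)).offDiag,
      ((if p.1 ∈ u then (1 : ℝ) else 0) + (if p.2 ∈ u then 1 else 0))
        = 2 * ((M : ℝ) - 1) * u.card := by
    have h₀ : ∑ i : Fin M, (if i ∈ u then (1 : ℝ) else 0) = u.card := by
      rw [Finset.sum_boole, Finset.filter_univ_mem]
    have h := fun f : Fin M × Fin M → ℝ => Finset.sum_product Finset.univ Finset.univ f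
    simp only [← Finset.diag_union_offDiag, Finset.sum_union (Finset.disjoint_diag_offDiag _),
      Finset.sum_diag] at h
    have h₁ := (h fun p => if p.1 ∈ u then (1 : ℝ) else 0).trans Finset.sum_comm
    have h₂ := h fun p => if p.2 ∈ u then (1 : ℝ) else 0
    simp only [h₀, Finset.sum_const, nsmul_eq_mul, Finset.card_univ, Fintype.card_fin] at h₁ h₂
    rw [Finset.sum_add_distrib, eq_sub_of_add_eq' h₁, eq_sub_of_add_eq' h₂]
    ring
  calc _ ≤ ∫ ξ, ∑ p ∈ (Finset.univ : Finset (Fin M)).offDiag,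
        (if step x ξ p.1 = step x ξ p.2 then (1 : ℝ) else 0) ∂stepMeasure G M :=
        integral_mono Integrable.of_finite Integrable.of_finite
          fun ξ => card_unsettled_le_sum (step x ξ)
    _ = ∑ p ∈ (Finset.univ : Finset (Fin M)).offDiag,
        ∫ ξ, (if step x ξ p.1 = step x ξ p.2 then (1 : ℝ) else 0) ∂stepMeasure G M :=
        integral_finsetSum _ fun _ _ => Integrable.of_finite
    _ ≤ ∑ p ∈ (Finset.univ : Finset (Fin M)).offDiag,
        a * ((if p.1 ∈ u then 1 else 0) + (if p.2 ∈ u then 1 else 0)) := Finset.sum_le_sum hpair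
    _ = _ := by rw [← Finset.mul_sum, hsum, ha]; ring

/-- The weight `y ^ #(unsettled S z)`, cut off at configurations with at least `k` unsettled
particles. -/
noncomputable def cutWeight {V : Type*} {M : ℕ} (k : ℕ) (y : ℝ) (S : Finset (Fin M))
    (z : Fin M → V) : ℝ :=
  if (unsettled S z).card < k then y ^ (unsettled S z).card else 0

/-- Only the destination of `i` is averaged. If `S` already has `k` unsettled particles, both
weights vanish; this is why the weight is cut off. Otherwise the settled particles of `S` occupy
more than `#S - k` distinct vertices, at most one of which is the forbidden vertex `x i`, so `i`
hits one with probability at least `p` and gains a factor `y ^ 2`. -/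
theorem integral_cutWeight_insert_le [DecidableEq V] (hV : 1 < Fintype.card V) {k : ℕ} {p y : ℝ}
    (hy0 : 0 ≤ y) (hy1 : y ≤ 1) {S : Finset (Fin M)} {i : Fin M}
    (hi : i ∈ unsettled Finset.univ x) (hG : ∀ w, w ≠ x i → G.Adj (x i) w) (hiS : i ∉ S)
    (hS : p * ((Fintype.card V : ℝ) - 1) ≤ (S.card : ℝ) - k - 1) :
    ∫ ξ, cutWeight k y (insert i S) (step x ξ) ∂stepMeasure G M
      ≤ (1 - p + p * y ^ 2) * ∫ ξ, cutWeight k y S (step x ξ) ∂stepMeasure G M := by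
  have hn : (0 : ℝ) < (Fintype.card V : ℝ) - 1 := by
    rw [sub_pos]; exact_mod_cast hV
  rw [integral_stepMeasure_update G M (i, x i), ← integral_const_mul]
  refine integral_mono Integrable.of_finite Integrable.of_finite fun ξ => ?_
  simp only [step_update ξ hi]
  set z := step x ξ
  have hz : ∀ w, unsettled S (Function.update z i w) = unsettled S z := fun w =>
    unsettled_congr fun j hj => Function.update_of_ne (ne_of_mem_of_not_mem hj hiS) _ _
  have hle : ∀ w, (unsettled S z).card ≤ (unsettled (insert i S) (Function.update z i w)).card :=
    fun w => hz w ▸ Finset.card_le_card (unsettled_mono (Finset.subset_insert _ _) _)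
  by_cases hk : (unsettled S z).card < k
  swap
  · have h₀ : ∀ w, cutWeight k y (insert i S) (Function.update z i w) = 0 := fun w =>
      if_neg fun h => hk ((hle w).trans_lt h)
    have h₁ : cutWeight k y S z = 0 := if_neg hk
    simp [h₀, h₁]
  set u := (unsettled S z).card with hu
  set T := (S \ unsettled S z).image z with hT
  have hTcard : (T.card : ℝ) = S.card - u := by
    rw [hT, Finset.card_image_of_injOn (injOn_sdiff_unsettled S z),
      Finset.card_sdiff_of_subset (unsettled_subset S z),
      Nat.cast_sub (Finset.card_le_card (unsettled_subset S z))]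
  have hp : p ≤ (neighborPMF G (x i)).toMeasure.real T := by
    rw [toMeasure_neighborPMF_real G (x i) hG hV, le_div_iff₀ hn]
    have h₁ : (T.card : ℝ) ≤ (T.erase (x i)).card + 1 := by
      have := Finset.pred_card_le_card_erase (s := T) (a := x i)
      exact_mod_cast (by omega : T.card ≤ (T.erase (x i)).card + 1)
    have h₂ : (u : ℝ) ≤ k := by exact_mod_cast hk.le
    linarith
  have hw : ∀ w, cutWeight k y (insert i S) (Function.update z i w)
      ≤ y ^ u * (1 - (1 - y ^ 2) * (if w ∈ T then 1 else 0)) := by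
    intro w
    have h₁ : cutWeight k y (insert i S) (Function.update z i w)
        ≤ y ^ (unsettled (insert i S) (Function.update z i w)).card := by
      unfold cutWeight
      split_ifs
      · exact le_rfl
      · positivity
    refine h₁.trans ?_
    split_ifs with hwT
    · obtain ⟨j, hj, rfl⟩ := Finset.mem_image.mp hwT
      rw [Finset.mem_sdiff] at hj
      have hji : j ≠ i := fun h => hiS (h ▸ hj.1)
      have := card_unsettled_insert (x := Function.update z i (z j)) hiS hj.1
        (by rw [hz]; exact hj.2) (by simp [hji])
      rw [hz] at this
      calc _ ≤ y ^ (u + 2) := pow_le_pow_of_le_one hy0 hy1 this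
        _ = _ := by ring
    · simpa using pow_le_pow_of_le_one hy0 hy1 (hle w)
  calc _ ≤ ∫ w, y ^ u * (1 - (1 - y ^ 2) * (if w ∈ T then 1 else 0))
        ∂(neighborPMF G (x i)).toMeasure :=
        integral_mono Integrable.of_finite Integrable.of_finite hw
    _ = y ^ u * (1 - (1 - y ^ 2) * (neighborPMF G (x i)).toMeasure.real T) := by
        rw [integral_const_mul, integral_sub (integrable_const _) Integrable.of_finite,
          integral_const_mul, integral_mem_neighborPMF]
        simp
    _ ≤ y ^ u * (1 - p + p * y ^ 2) := by
        gcongr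
        nlinarith [mul_le_mul_of_nonneg_left hp (sub_nonneg.mpr (pow_le_one₀ hy0 hy1 (n := 2)))]
    _ = _ := by rw [cutWeight, if_pos hk, mul_comm]

theorem integral_unsettled_lt_le [DecidableEq V] (hV : 1 < Fintype.card V) {k : ℕ} {p y : ℝ}
    (hp0 : 0 ≤ p) (hp1 : p ≤ 1) (hy0 : 0 < y) (hy1 : y ≤ 1)
    (hG : ∀ i ∈ unsettled Finset.univ x, ∀ w, w ≠ x i → G.Adj (x i) w)
    (hk : k ≤ (unsettled Finset.univ x).card)
    (hM : p * ((Fintype.card V : ℝ) - 1) ≤ (M : ℝ) - 2 * k - 1) :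
    ∫ ξ, (if (unsettled Finset.univ (step x ξ)).card < k then (1 : ℝ) else 0) ∂stepMeasure G M
      ≤ ((1 - p) / y + p * y) ^ k := by
  -- Only the particles of `K` are revealed one at a time. The starting set `Kᶜ` has `M - k`
  -- particles, possibly including further movers, and this accounts for the `2 * k` in `hM`.
  obtain ⟨K, hKu, hKk⟩ := Finset.exists_subset_card_eq hk
  set θ := 1 - p + p * y ^ 2 with hθ
  have hθ0 : 0 ≤ θ := by have := sub_nonneg.mpr hp1; positivity
  have hJ : ∀ J ⊆ K, ∫ ξ, cutWeight k y (Kᶜ ∪ J) (step x ξ) ∂stepMeasure G M ≤ θ ^ J.card := by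
    intro J
    induction J using Finset.induction_on with
    | empty =>
      intro _
      have h : ∀ ξ : Fin M × V → V, cutWeight k y (Kᶜ ∪ ∅) (step x ξ) ≤ 1 := by
        intro ξ
        unfold cutWeight
        split_ifs
        · exact pow_le_one₀ hy0.le hy1
        · exact zero_le_one
      refine (integral_mono Integrable.of_finite (integrable_const _) h).trans ?_
      simp
    | insert i J hi ih =>
      intro hJK
      have hiK : i ∈ K := hJK (Finset.mem_insert_self _ _)
      have hiS : i ∉ Kᶜ ∪ J := by simp [hi, hiK]
      rw [Finset.union_insert, Finset.card_insert_of_notMem hi, pow_succ']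
      refine (integral_cutWeight_insert_le (p := p) hV hy0.le hy1 (hKu hiK) (hG i (hKu hiK)) hiS
        ?_).trans ?_
      · have h₁ : (Kᶜ.card : ℝ) ≤ (Kᶜ ∪ J).card := by
          exact_mod_cast Finset.card_le_card Finset.subset_union_left
        have h₂ : (Kᶜ.card : ℝ) = M - k := by
          have := Finset.card_add_card_compl K
          rw [hKk, Fintype.card_fin] at this
          have h : (k : ℝ) + Kᶜ.card = M := by exact_mod_cast this
          linarith
        linarith
      · exact mul_le_mul_of_nonneg_left (ih ((Finset.subset_insert _ _).trans hJK)) hθ0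
  have hfin := hJ K subset_rfl
  rw [show Kᶜ ∪ K = Finset.univ by rw [Finset.union_comm]; exact Finset.union_compl K, hKk] at hfin
  -- Exponential Markov inequality: below the cutoff, `y ^ u ≥ y ^ k`.
  calc _ ≤ ∫ ξ, y⁻¹ ^ k * cutWeight k y Finset.univ (step x ξ) ∂stepMeasure G M := by
        refine integral_mono Integrable.of_finite Integrable.of_finite fun ξ => ?_
        simp only [cutWeight]
        split_ifs with h
        · rw [inv_pow, inv_mul_eq_div, one_le_div (by positivity)]
          exact pow_le_pow_of_le_one hy0.le hy1 h.le
        · simp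
    _ = y⁻¹ ^ k * ∫ ξ, cutWeight k y Finset.univ (step x ξ) ∂stepMeasure G M :=
        integral_const_mul _ _
    _ ≤ y⁻¹ ^ k * θ ^ k := by gcongr
    _ = _ := by
        rw [← mul_pow, hθ]
        congr 1
        field_simp

end OneStep

end Dispersion

/-! ### Reduction of the dispersion time to one configuration. -/

namespace Dispersion

section DispersionTime

variable {V : Type*} {M : ℕ}

theorem dispersed_config_mono (o : V) (ω : Choices V M) {s t : ℕ} (hst : s ≤ t)
    (h : Dispersed (config o ω s)) : Dispersed (config o ω t) := by
  induction t, hst using Nat.le_induction with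
  | base => exact h
  | succ t _ ih =>
    rwa [config, step_of_unsettled_eq_empty _ (dispersed_iff.mp ih)]

/-- Dispersed configurations are absorbing, so it suffices to look at the last integer time up to
`r`. -/
theorem dispersionTime_le_iff (o : V) (ω : Choices V M) {r : ℝ} (hr : 0 ≤ r) :
    (dispersionTime o ω : ℝ≥0∞) ≤ ENNReal.ofReal r ↔ Dispersed (config o ω ⌊r⌋₊) := by
  constructor
  · intro h
    have h' : dispersionTime o ω < ((⌊r⌋₊ + 1 : ℕ) : ℕ∞) := by
      generalize dispersionTime o ω = T at h
      induction T using ENat.recTopCoe with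
      | top => simp at h
      | coe m =>
        rw [ENat.toENNReal_coe, ← ENNReal.ofReal_natCast, ENNReal.ofReal_le_ofReal_iff hr] at h
        have := Nat.le_floor h
        exact_mod_cast Nat.lt_succ_of_le this
    simp only [dispersionTime, iInf_lt_iff] at h'
    obtain ⟨t, ht, hlt⟩ := h'
    have : t < ⌊r⌋₊ + 1 := by exact_mod_cast hlt
    exact dispersed_config_mono o ω (Nat.le_of_lt_succ this) ht
  · intro h
    have h' : dispersionTime o ω ≤ (⌊r⌋₊ : ℕ∞) :=
      iInf₂_le (f := fun (t : ℕ) (_ : Dispersed (config o ω t)) => (t : ℕ∞)) _ h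
    calc (dispersionTime o ω : ℝ≥0∞) ≤ ((⌊r⌋₊ : ℕ∞) : ℝ≥0∞) := by exact_mod_cast h'
      _ = ENNReal.ofReal (⌊r⌋₊ : ℝ) := by rw [ENat.toENNReal_coe, ENNReal.ofReal_natCast]
      _ ≤ ENNReal.ofReal r := ENNReal.ofReal_le_ofReal (Nat.floor_le hr)

variable [Fintype V] [MeasurableSpace V]

theorem probDispersedWithin_eq (G : SimpleGraph V) (o : V) {r : ℝ} (hr : 0 ≤ r) :
    probDispersedWithin G M o r
      = (choiceMeasure G M).real {ω | Dispersed (config o ω ⌊r⌋₊)} := by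
  simp only [probDispersedWithin, dispersionTime_le_iff o _ hr]

variable [MeasurableSingletonClass V]

theorem measurableSet_config (o : V) (t : ℕ) (s : Set (Fin M → V)) :
    MeasurableSet {ω : Choices V M | config o ω t ∈ s} :=
  measurable_config o t s.toFinite.measurableSet

end DispersionTime

/-! ### Alternating phases on the star. -/

section Phases

variable {V : Type*} {M : ℕ}

/-- At the times in `F` every particle about to move is at a vertex adjacent to all others; at
other times the set of particles about to move does not change. No two consecutive times
are outside `F`. -/
structure FullPhases [Fintype V] [MeasurableSpace V] (G : SimpleGraph V) (M : ℕ) (o : V)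
    (F : ℕ → Prop) : Prop where
  frequent : ∀ t, F t ∨ F (t + 1)
  full : ∀ᵐ ω ∂choiceMeasure G M, ∀ t, F t → ∀ i ∈ unsettled Finset.univ (config o ω t),
    ∀ w, w ≠ config o ω t i → G.Adj (config o ω t i) w
  still : ∀ᵐ ω ∂choiceMeasure G M, ∀ t, ¬ F t →
    unsettled Finset.univ (config o ω (t + 1)) = unsettled Finset.univ (config o ω t)

theorem fullPhases_top [Fintype V] [MeasurableSpace V] (M : ℕ) (o : V) :
    FullPhases (⊤ : SimpleGraph V) M o fun _ => True where
  frequent _ := .inl trivial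
  full := .of_forall fun _ _ _ _ _ _ hw => hw.symm
  still := .of_forall fun _ _ h => absurd trivial h

/-- Every particle about to move is at `r`. -/
def MoversAt (r : V) (x : Fin M → V) : Prop :=
  ∀ i ∈ unsettled Finset.univ x, x i = r

/-- Either `r` is vacant or nobody is about to move. -/
def VacantOrSettled (r : V) (x : Fin M → V) : Prop :=
  (∀ i, x i ≠ r) ∨ unsettled Finset.univ x = ∅

variable {r : V} {x : Fin M → V} {ξ : Fin M × V → V}

/-- If some mover is at `r`, then every particle at `r` is a mover and leaves. Without movers, a
settled particle may remain at `r`, whence the second alternative. -/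
theorem MoversAt.step (hx : MoversAt r x) (hξ : ∀ i, ξ (i, r) ≠ r) :
    VacantOrSettled r (step x ξ) := by
  rcases (unsettled Finset.univ x).eq_empty_or_nonempty with h | ⟨m, hm⟩
  · right
    rwa [step_of_unsettled_eq_empty ξ h]
  · left
    intro i
    by_cases hi : i ∈ unsettled Finset.univ x
    · rw [step_of_mem ξ hi, hx i hi]
      exact hξ i
    · rw [step_of_notMem ξ hi]
      intro hir
      exact hi (mem_unsettled_univ.mpr ⟨m, fun h => hi (h ▸ hm), (hx m hm).trans hir.symm⟩)

/-- All movers meet at the vacant `r`. There are at least two of them if there is one, so they stay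
unsettled, and they disturb nobody else. -/
theorem VacantOrSettled.unsettled_step (hx : VacantOrSettled r x)
    (hξ : ∀ i v, v ≠ r → ξ (i, v) = r) :
    unsettled Finset.univ (Dispersion.step x ξ) = unsettled Finset.univ x := by
  rcases hx with hx | hx
  swap
  · rw [step_of_unsettled_eq_empty ξ hx]
  have h₁ : ∀ i ∈ unsettled Finset.univ x, Dispersion.step x ξ i = r := fun i hi => by
    rw [step_of_mem ξ hi, hξ i _ (hx i)]
  ext i
  constructor
  · intro hi
    by_contra hiu
    obtain ⟨j, hji, hj⟩ := mem_unsettled_univ.mp hi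
    rw [step_of_notMem ξ hiu] at hj
    by_cases hju : j ∈ unsettled Finset.univ x
    · exact hx i ((h₁ j hju).symm.trans hj).symm
    · rw [step_of_notMem ξ hju] at hj
      exact hiu (mem_unsettled_univ.mpr ⟨j, hji, hj⟩)
  · intro hi
    obtain ⟨j, hji, hj⟩ := mem_unsettled_univ.mp hi
    have hju : j ∈ unsettled Finset.univ x := mem_unsettled_univ.mpr ⟨i, hji.symm, hj.symm⟩
    exact mem_unsettled_univ.mpr ⟨j, hji, by rw [h₁ i hi, h₁ j hju]⟩

theorem VacantOrSettled.step (hx : VacantOrSettled r x) (hξ : ∀ i v, v ≠ r → ξ (i, v) = r) :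
    MoversAt r (step x ξ) := by
  intro i hi
  rw [hx.unsettled_step hξ] at hi
  rcases hx with hx | hx
  · rw [step_of_mem ξ hi, hξ i _ (hx i)]
  · simp [hx] at hi

theorem config_star_phases (o : V) {ω : Choices V M} (h₁ : ∀ t i, ω t (i, r) ≠ r)
    (h₂ : ∀ t i v, v ≠ r → ω t (i, v) = r) (t : ℕ) :
    ((Even t ↔ o = r) → MoversAt r (config o ω t)) ∧
      (¬ (Even t ↔ o = r) → VacantOrSettled r (config o ω t)) := by
  induction t with
  | zero =>
    constructor
    · intro h i _
      exact h.mp Even.zero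
    · intro h
      exact .inl fun i hi => h ⟨fun _ => hi, fun _ => Even.zero⟩
  | succ t ih =>
    have hpar : (Even (t + 1) ↔ o = r) ↔ ¬ (Even t ↔ o = r) := by
      rw [Nat.even_add_one]
      tauto
    rw [hpar]
    exact ⟨fun h => (ih.2 h).step (h₂ t), fun h => (ih.1 (not_not.mp h)).step (h₁ t)⟩

theorem fullPhases_star [Fintype V] [MeasurableSpace V] [MeasurableSingletonClass V]
    (hV : 1 < Fintype.card V) (M : ℕ) (r o : V) :
    FullPhases (SimpleGraph.starGraph r) M o fun t => (Even t ↔ o = r) := by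
  have hmoves : ∀ᵐ ω ∂choiceMeasure (SimpleGraph.starGraph r) M,
      (∀ t i, ω t (i, r) ≠ r) ∧ ∀ t i v, v ≠ r → ω t (i, v) = r := by
    filter_upwards [ae_adj (SimpleGraph.starGraph r) M] with ω hω
    refine ⟨fun t i => ?_, fun t i v hv => ?_⟩
    · obtain ⟨w, hw⟩ := Fintype.exists_ne_of_one_lt_card hV r
      exact (hω t i r ⟨w, SimpleGraph.starGraph_center_adj hw.symm⟩).ne'
    · have := hω t i v ⟨r, SimpleGraph.starGraph_center_adj' hv.symm⟩
      rw [SimpleGraph.starGraph_adj] at this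
      exact this.2.resolve_left hv
  refine ⟨fun t => ?_, ?_, ?_⟩
  · rw [Nat.even_add_one]
    tauto
  · filter_upwards [hmoves] with ω hω t ht i hi w hw
    have := (config_star_phases o hω.1 hω.2 t).1 ht i hi
    rw [this] at hw ⊢
    exact SimpleGraph.starGraph_center_adj hw.symm
  · filter_upwards [hmoves] with ω hω t ht
    exact ((config_star_phases o hω.1 hω.2 t).2 ht).unsettled_step (hω.2 t)

end Phases

/-! ### Iterating the one-step estimates. -/

section Evolution

variable {V : Type*} [Fintype V] [MeasurableSpace V] [MeasurableSingletonClass V]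
  {G : SimpleGraph V} {M : ℕ} {o : V} {F : ℕ → Prop}

theorem FullPhases.integral_card_unsettled_le (hF : FullPhases G M o F) (hV : 1 < Fintype.card V)
    {q : ℝ} (hq1 : q ≤ 1)
    (hq : 2 * ((M : ℝ) - 1) / ((Fintype.card V : ℝ) - 1) ≤ q) (hq0 : 0 ≤ q) (s : ℕ) :
    ∫ ω, ((unsettled Finset.univ (config o ω (2 * s))).card : ℝ) ∂choiceMeasure G M
      ≤ q ^ s * M := by
  classical
  set E : ℕ → ℝ := fun t =>
    ∫ ω, ((unsettled Finset.univ (config o ω t)).card : ℝ) ∂choiceMeasure G M with hE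
  have hE0 : ∀ t, 0 ≤ E t := fun t => integral_nonneg fun _ => Nat.cast_nonneg _
  have hfull : ∀ t, F t → E (t + 1) ≤ q * E t := by
    intro t ht
    simp only [hE]
    rw [integral_config_succ G o t fun x => ((unsettled Finset.univ x).card : ℝ),
      ← integral_const_mul]
    refine integral_mono_ae
      (integrable_config G o t fun x =>
        ∫ ξ, ((unsettled Finset.univ (step x ξ)).card : ℝ) ∂stepMeasure G M)
      (integrable_config G o t fun x => q * ((unsettled Finset.univ x).card : ℝ)) ?_
    filter_upwards [hF.full] with ω hω
    refine (integral_card_unsettled_step_le hV (hω t ht)).trans ?_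
    gcongr
  have hstill : ∀ t, ¬ F t → E (t + 1) = E t := by
    intro t ht
    refine integral_congr_ae ?_
    filter_upwards [hF.still] with ω hω
    rw [hω t ht]
  have hanti : ∀ t, E (t + 1) ≤ E t := by
    intro t
    by_cases ht : F t
    · exact (hfull t ht).trans (mul_le_of_le_one_left (hE0 t) hq1)
    · exact (hstill t ht).le
  -- At least one of two consecutive steps contracts, and the other does no harm because `q ≤ 1`.
  have htwo : ∀ t, E (t + 1 + 1) ≤ q * E t := by
    intro t
    rcases hF.frequent t with ht | ht
    · exact (hanti _).trans (hfull t ht)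
    · exact (hfull _ ht).trans (mul_le_mul_of_nonneg_left (hanti t) hq0)
  change E (2 * s) ≤ _
  induction s with
  | zero =>
    have : ∀ ω : Choices V M, ((unsettled Finset.univ (config o ω 0)).card : ℝ) ≤ M := fun ω => by
      exact_mod_cast (Finset.card_le_univ _).trans_eq (Fintype.card_fin M)
    refine (integral_mono (integrable_config G o 0 fun x => ((unsettled Finset.univ x).card : ℝ))
      (integrable_const _) this).trans ?_
    simp
  | succ s ih =>
    calc E (2 * s + 1 + 1) ≤ q * E (2 * s) := htwo _
      _ ≤ q * (q ^ s * M) := mul_le_mul_of_nonneg_left ih hq0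
      _ = _ := by ring

theorem one_sub_integral_card_le (G : SimpleGraph V) (o : V) (t : ℕ) :
    1 - ∫ ω, ((unsettled Finset.univ (config o ω t)).card : ℝ) ∂choiceMeasure G M
      ≤ (choiceMeasure G M).real {ω | Dispersed (config o ω t)} := by
  have hm : MeasurableSet {ω : Choices V M | Dispersed (config o ω t)} :=
    measurableSet_config o t {x | Dispersed x}
  have hi : Integrable ({ω : Choices V M | Dispersed (config o ω t)}.indicator (1 : Choices V M → ℝ))
      (choiceMeasure G M) := (integrable_const (1 : ℝ)).indicator hm
  have hc := integrable_config G o t fun x : Fin M → V => ((unsettled Finset.univ x).card : ℝ)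
  rw [← integral_indicator_one hm, sub_le_iff_le_add, ← integral_add hi hc]
  calc (1 : ℝ) = ∫ _, (1 : ℝ) ∂choiceMeasure G M := by simp
    _ ≤ _ := by
      refine integral_mono (integrable_const _) (hi.add hc) fun ω => ?_
      by_cases h : Dispersed (config o ω t)
      · simp [h]
      · have : 0 < (unsettled Finset.univ (config o ω t)).card :=
          Finset.card_pos.mpr (Finset.nonempty_iff_ne_empty.mpr fun h' => h (dispersed_iff.mpr h'))
        simpa [h] using Nat.one_le_iff_ne_zero.mpr this.ne'

theorem FullPhases.prob_dispersed_le (hF : FullPhases G M o F) (hV : 1 < Fintype.card V) {k : ℕ}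
    {p y : ℝ} (hp0 : 0 ≤ p) (hp1 : p ≤ 1) (hy0 : 0 < y) (hy1 : y ≤ 1) (hk : 0 < k)
    (hkM : k ≤ M) (hM2 : 2 ≤ M)
    (hM : p * ((Fintype.card V : ℝ) - 1) ≤ (M : ℝ) - 2 * k - 1) (t : ℕ) :
    (choiceMeasure G M).real {ω | Dispersed (config o ω t)}
      ≤ t * ((1 - p) / y + p * y) ^ k := by
  classical
  set ρ := ((1 - p) / y + p * y) ^ k with hρ
  have hρ0 : 0 ≤ ρ := by have := sub_nonneg.mpr hp1; positivity
  set f : (Fin M → V) → ℝ := fun x => if (unsettled Finset.univ x).card < k then 1 else 0 with hf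
  have hf0 : ∀ x, 0 ≤ f x := fun x => by simp only [hf]; split_ifs <;> norm_num
  -- Union bound over time: each step adds at most `ρ` to the probability of having fewer than `k`
  -- unsettled particles.
  have hstep : ∀ t, ∫ ω, f (config o ω (t + 1)) ∂choiceMeasure G M
      ≤ ∫ ω, f (config o ω t) ∂choiceMeasure G M + ρ := by
    intro t
    by_cases ht : F t
    · have : ∫ ω, f (config o ω t) ∂choiceMeasure G M + ρ
          = ∫ ω, (f (config o ω t) + ρ) ∂choiceMeasure G M := by
        rw [integral_add (integrable_config G o t f) (integrable_const _)]
        simp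
      rw [integral_config_succ, this]
      refine integral_mono_ae
        (integrable_config G o t fun x => ∫ ξ, f (step x ξ) ∂stepMeasure G M)
        (integrable_config G o t fun x => f x + ρ) ?_
      filter_upwards [hF.full] with ω hω
      by_cases hlt : (unsettled Finset.univ (config o ω t)).card < k
      · have h₁ : ∫ ξ, f (step (config o ω t) ξ) ∂stepMeasure G M ≤ 1 := by
          refine (integral_mono Integrable.of_finite (integrable_const 1) fun ξ => ?_).trans
            (by simp)
          simp only [hf]
          split_ifs <;> norm_num
        have h₂ : f (config o ω t) = 1 := if_pos hlt
        change _ ≤ f (config o ω t) + ρ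
        linarith
      · have := integral_unsettled_lt_le hV hp0 hp1 hy0 hy1 (hω t ht) (not_lt.mp hlt) hM
        exact this.trans (le_add_of_nonneg_left (hf0 _))
    · have : ∫ ω, f (config o ω (t + 1)) ∂choiceMeasure G M
          = ∫ ω, f (config o ω t) ∂choiceMeasure G M := by
        refine integral_congr_ae ?_
        filter_upwards [hF.still] with ω hω
        simp only [hf, hω t ht]
      rw [this]
      linarith
  have hint : ∫ ω, f (config o ω t) ∂choiceMeasure G M ≤ t * ρ := by
    induction t with
    | zero =>
      have huniv : unsettled Finset.univ (fun _ : Fin M => o) = Finset.univ := by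
        refine Finset.eq_univ_of_forall fun i => mem_unsettled_univ.mpr ?_
        obtain ⟨j, hj⟩ := Fintype.exists_ne_of_one_lt_card (by rw [Fintype.card_fin]; omega) i
        exact ⟨j, hj, rfl⟩
      simp [hf, config, huniv, not_lt.mpr hkM]
    | succ t ih =>
      push_cast
      linarith [hstep t]
  refine le_trans ?_ hint
  have hm : MeasurableSet {ω : Choices V M | Dispersed (config o ω t)} :=
    measurableSet_config o t {x | Dispersed x}
  rw [← integral_indicator_one hm]
  refine integral_mono ((integrable_const (1 : ℝ)).indicator hm) (integrable_config G o t f)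
    fun ω => ?_
  by_cases h : Dispersed (config o ω t)
  · simp [h, hf, dispersed_iff.mp h, hk]
  · simpa [h] using hf0 _

/-- By pigeonhole some vertex has probability at least `1 / card V` as a first destination, and two
given particles may both choose it. -/
theorem prob_dispersed_one_le (G : SimpleGraph V) (o : V) (hM : 2 ≤ M) :
    (choiceMeasure G M).real {ω | Dispersed (config o ω 1)}
      ≤ 1 - (1 / (Fintype.card V : ℝ)) ^ 2 := by
  classical
  have hVpos : (0 : ℝ) < Fintype.card V := by exact_mod_cast Fintype.card_pos_iff.mpr ⟨o⟩
  set μ := (neighborPMF G o).toMeasure with hμ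
  obtain ⟨w, hw⟩ : ∃ w, 1 / (Fintype.card V : ℝ) ≤ μ.real {w} := by
    have h : ∑ w : V, 1 / (Fintype.card V : ℝ) ≤ ∑ w, μ.real {w} := by
      rw [sum_measureReal_singleton]
      simp [hVpos.ne']
    obtain ⟨w, -, hw⟩ := Finset.exists_le_of_sum_le ⟨o, Finset.mem_univ o⟩ h
    exact ⟨w, hw⟩
  let i : Fin M := ⟨0, by omega⟩
  let j : Fin M := ⟨1, by omega⟩
  have hij : i ≠ j := by simp [i, j]
  set C : Set (Choices V M) := {ω | ω 0 ∈ Set.pi ((({(i, o), (j, o)} : Finset (Fin M × V))) :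
    Set (Fin M × V)) fun _ => ({w} : Set V)} with hC
  have hCm : (choiceMeasure G M).real C = μ.real {w} ^ 2 := by
    have h₁ := (measurePreserving_eval_infinitePi (fun _ : ℕ => stepMeasure G M) 0).measureReal_preimage
      (s := Set.pi ((({(i, o), (j, o)} : Finset (Fin M × V))) : Set (Fin M × V))
        fun _ => ({w} : Set V)) (Set.toFinite _).measurableSet.nullMeasurableSet
    refine h₁.trans ?_
    rw [stepMeasure, ← Measure.infinitePi_eq_pi, Measure.real,
      Measure.infinitePi_pi _ fun _ _ => measurableSet_singleton w,
      Finset.prod_pair (by simp [hij]), ENNReal.toReal_mul, sq]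
    rfl
  have hsub : {ω : Choices V M | Dispersed (config o ω 1)} ⊆ Cᶜ := by
    intro ω hω hωC
    simp only [hC, Set.mem_ofPred_eq, Set.mem_pi, Finset.mem_coe, Finset.mem_insert,
      Finset.mem_singleton, Set.mem_singleton_iff] at hωC
    have hall : ∀ l : Fin M, l ∈ unsettled Finset.univ (fun _ : Fin M => o) := fun l => by
      obtain ⟨m, hm⟩ := Fintype.exists_ne_of_one_lt_card (by rw [Fintype.card_fin]; omega) l
      exact mem_unsettled_univ.mpr ⟨m, hm, rfl⟩
    have hmove : ∀ l : Fin M, config o ω 1 l = ω 0 (l, o) := fun l => step_of_mem _ (hall l)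
    have hmem : i ∈ unsettled Finset.univ (config o ω 1) := mem_unsettled_univ.mpr
      ⟨j, hij.symm, by rw [hmove, hmove, hωC _ (.inl rfl), hωC _ (.inr rfl)]⟩
    rw [dispersed_iff.mp hω] at hmem
    simp at hmem
  have hCmeas : MeasurableSet C :=
    measurable_pi_apply 0 (Set.toFinite _).measurableSet
  calc _ ≤ (choiceMeasure G M).real Cᶜ := measureReal_mono hsub
    _ = 1 - μ.real {w} ^ 2 := by rw [probReal_compl_eq_one_sub hCmeas, hCm]
    _ ≤ _ := by gcongr

end Evolution

end Dispersion

/-! ### Choice of constants in the two regimes. -/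

namespace Dispersion

theorem exists_fullPhases {n : ℕ} {G : SimpleGraph (Fin n)}
    (hG : G = ⊤ ∨ ∃ r : Fin n, G = SimpleGraph.starGraph r) (hn : 1 < n) (M : ℕ) (o : Fin n) :
    ∃ F, FullPhases G M o F := by
  rcases hG with rfl | ⟨r, rfl⟩
  · exact ⟨_, fullPhases_top M o⟩
  · exact ⟨_, fullPhases_star (by rwa [Fintype.card_fin]) M r o⟩

theorem probDispersedWithin_subcritical {δ : ℝ} (hδ : 0 < δ) {n : ℕ} {G : SimpleGraph (Fin n)}
    (hG : G = ⊤ ∨ ∃ r : Fin n, G = SimpleGraph.starGraph r) (M : ℕ) (o : Fin n)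
    (hM : (M : ℝ) / n ≤ (1 / 2) * (1 - δ)) :
    1 - Real.exp δ / n ≤ probDispersedWithin G M o (4 / δ * Real.log n) := by
  have hn0 : 0 < n := o.pos
  have hnR : (1 : ℝ) ≤ n := by exact_mod_cast hn0
  have hnpos : (0 : ℝ) < n := by linarith
  have hlog : 0 ≤ Real.log n := Real.log_nonneg hnR
  rw [div_le_iff₀ hnpos] at hM
  rw [probDispersedWithin_eq G o (by positivity)]
  -- `s` counts pairs of steps, each contributing a factor `1 - δ`. Then `(1 - δ) ^ s` is at most
  -- `exp δ / n ^ 2`, where `exp δ` pays for the floor and one factor `n` is lost to `M ≤ n`.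
  set s := ⌊2 / δ * Real.log n⌋₊ with hs
  have hst : 2 * s ≤ ⌊4 / δ * Real.log n⌋₊ := by
    refine Nat.le_floor ?_
    push_cast
    have := Nat.floor_le (show 0 ≤ 2 / δ * Real.log n by positivity)
    calc (2 : ℝ) * s ≤ 2 * (2 / δ * Real.log n) := by gcongr
      _ = _ := by ring
  refine le_trans ?_ (measureReal_mono (μ := choiceMeasure G M)
    (s₁ := {ω | Dispersed (config o ω (2 * s))}) fun ω => dispersed_config_mono o ω hst)
  refine le_trans (sub_le_sub_left ?_ 1) (one_sub_integral_card_le G o (2 * s))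
  rcases Nat.eq_zero_or_pos M with rfl | hMpos
  · have : ∀ ω, (unsettled Finset.univ (config (M := 0) o ω (2 * s))) = ∅ := fun ω =>
      Finset.eq_empty_of_isEmpty _
    simp only [this, Finset.card_empty, Nat.cast_zero, integral_zero]
    positivity
  have hM1 : (1 : ℝ) ≤ M := by exact_mod_cast hMpos
  have hδ1 : δ < 1 := by
    by_contra h
    nlinarith
  have hn1 : 1 < n := by
    have : (1 : ℝ) < n := by nlinarith
    exact_mod_cast this
  have hn1' : (0 : ℝ) < (n : ℝ) - 1 := by rw [sub_pos]; exact_mod_cast hn1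
  obtain ⟨F, hF⟩ := exists_fullPhases hG hn1 M o
  refine (hF.integral_card_unsettled_le (by rwa [Fintype.card_fin]) (q := 1 - δ) (by linarith)
    ?_ (by linarith) s).trans ?_
  · rw [Fintype.card_fin, div_le_iff₀ hn1']
    nlinarith
  have h₁ : (1 - δ) ^ s ≤ Real.exp (-(δ * s)) := by
    calc (1 - δ) ^ s ≤ Real.exp (-δ) ^ s :=
          pow_le_pow_left₀ (by linarith) (Real.one_sub_le_exp_neg δ) s
      _ = _ := by rw [← Real.exp_nat_mul]; ring_nf
  have h₂ : -(δ * s) ≤ δ - 2 * Real.log n := by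
    have := (Nat.lt_floor_add_one (2 / δ * Real.log n)).le
    rw [← hs] at this
    have h := mul_le_mul_of_nonneg_left this hδ.le
    have h' : δ * (2 / δ * Real.log n) = 2 * Real.log n := by field_simp
    linarith
  have h₃ : Real.exp (δ - 2 * Real.log n) = Real.exp δ / n ^ 2 := by
    rw [Real.exp_sub, two_mul, Real.exp_add, Real.exp_log hnpos, sq]
  have hMn : (M : ℝ) ≤ n := by nlinarith
  calc (1 - δ) ^ s * M ≤ Real.exp δ / n ^ 2 * n := by
        refine mul_le_mul (h₁.trans (h₃ ▸ Real.exp_le_exp.mpr h₂)) hMn (by positivity)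
          (by positivity)
    _ = _ := by field_simp

/-- The per-mover factor in the bound for the loss of unsettled particles in one step. -/
noncomputable def lossFactor (δ : ℝ) : ℝ :=
  (1 - (1 / 2 + δ / 8)) / (1 - δ / 8) + (1 / 2 + δ / 8) * (1 - δ / 8)

theorem lossFactor_pos {δ : ℝ} (hδ : 0 < δ) (hδ1 : δ < 1) : 0 < lossFactor δ := by
  have h₁ : 0 < 1 - δ / 8 := by linarith
  have h₂ : 0 < 1 - (1 / 2 + δ / 8) := by linarith
  unfold lossFactor
  positivity

/-- For `0 < y < 1`, `(1 - p) / y + p * y < 1` is equivalent to `p * (1 + y) > 1`. With `p = 1/2 +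
δ/8` and `y = 1 - δ/8` the product is `1 + 3δ/16 - δ²/64`. -/
theorem lossFactor_lt_one {δ : ℝ} (hδ : 0 < δ) (hδ1 : δ < 1) : lossFactor δ < 1 := by
  have h₁ : 0 < 1 - δ / 8 := by linarith
  rw [lossFactor, ← lt_sub_iff_add_lt, div_lt_iff₀ h₁]
  nlinarith [mul_pos hδ hδ, mul_pos (mul_pos hδ hδ) (sub_pos.mpr hδ1)]

/-- The exponential rate in the supercritical regime. -/
noncomputable def survivalRate (δ : ℝ) : ℝ :=
  min (δ / 16 * -Real.log (lossFactor δ) / 3) ((δ / 12) ^ 3)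

theorem survivalRate_pos {δ : ℝ} (hδ : 0 < δ) (hδ1 : δ < 1) : 0 < survivalRate δ := by
  have := neg_pos.mpr (Real.log_neg (lossFactor_pos hδ hδ1) (lossFactor_lt_one hδ hδ1))
  unfold survivalRate
  positivity

theorem probDispersedWithin_supercritical {δ : ℝ} (hδ : 0 < δ) (hδ1 : δ < 1) {n : ℕ}
    {G : SimpleGraph (Fin n)} (hG : G = ⊤ ∨ ∃ r : Fin n, G = SimpleGraph.starGraph r) (M : ℕ)
    (o : Fin n) (hM : (1 / 2) * (1 + δ) ≤ (M : ℝ) / n) (hMn : (M : ℝ) / n < 1) :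
    probDispersedWithin G M o (Real.exp (survivalRate δ * n))
      < Real.exp (-(survivalRate δ * n)) := by
  have hc := survivalRate_pos hδ hδ1
  have hρ0 := lossFactor_pos hδ hδ1
  -- The first bound serves large `n`: it makes the loss per step at most `exp (-3cn)`, leaving `exp
  -- (-2cn)` after `exp (cn)` steps. The second serves small `n`, giving `c * n ^ 3 < 1`.
  have hc₁ : survivalRate δ ≤ δ / 16 * -Real.log (lossFactor δ) / 3 := min_le_left _ _
  have hc₂ : survivalRate δ ≤ (δ / 12) ^ 3 := min_le_right _ _
  set c := survivalRate δ
  have hn0 : 0 < n := o.pos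
  have hnpos : (0 : ℝ) < n := by exact_mod_cast hn0
  rw [le_div_iff₀ hnpos] at hM
  rw [div_lt_one hnpos] at hMn
  have hMn' : M < n := by exact_mod_cast hMn
  have hn1 : 1 < n := by
    have : 0 < M := by
      have : (0 : ℝ) < M := lt_of_lt_of_le (by positivity) hM
      exact_mod_cast this
    omega
  have hM2 : 2 ≤ M := by
    have h₁ : (2 : ℝ) ≤ n := by exact_mod_cast hn1
    have : (1 : ℝ) < M := by nlinarith
    exact_mod_cast this
  rw [probDispersedWithin_eq G o (Real.exp_pos _).le]
  -- With `k < δn/16 + 1`, the inequality `p (n - 1) ≤ M - 2k - 1` follows once `δn/4 ≥ 3`.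
  rcases le_or_gt (12 / δ) n with hlarge | hsmall
  · rw [div_le_iff₀ hδ] at hlarge
    obtain ⟨F, hF⟩ := exists_fullPhases hG hn1 M o
    set k := ⌈δ / 16 * n⌉₊ with hk
    have hkpos : 0 < k := Nat.ceil_pos.mpr (by positivity)
    have hk₁ : δ / 16 * n ≤ k := Nat.le_ceil _
    have hk₂ : (k : ℝ) < δ / 16 * n + 1 := Nat.ceil_lt_add_one (by positivity)
    have hkM : k ≤ M := by
      have : (k : ℝ) ≤ M := by nlinarith
      exact_mod_cast this
    refine (hF.prob_dispersed_le (p := 1 / 2 + δ / 8) (y := 1 - δ / 8) (k := k)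
      (by rwa [Fintype.card_fin]) (by linarith) (by linarith) (by linarith) (by linarith) hkpos
      hkM hM2 ?_ _).trans_lt ?_
    · rw [Fintype.card_fin]
      nlinarith
    change _ * lossFactor δ ^ k < _
    have hpow : lossFactor δ ^ k ≤ Real.exp (-(3 * (c * n))) := by
      rw [← Real.exp_log (pow_pos hρ0 k), Real.log_pow]
      refine Real.exp_le_exp.mpr ?_
      have hL := neg_pos.mpr (Real.log_neg hρ0 (lossFactor_lt_one hδ hδ1))
      nlinarith [mul_le_mul_of_nonneg_right hk₁ hL.le, mul_le_mul_of_nonneg_right hc₁ hnpos.le]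
    calc _ ≤ Real.exp (c * n) * Real.exp (-(3 * (c * n))) := by
          gcongr
          exact Nat.floor_le (Real.exp_pos _).le
      _ = Real.exp (-(2 * (c * n))) := by rw [← Real.exp_add]; ring_nf
      _ < _ := Real.exp_lt_exp.mpr (by nlinarith [mul_pos hc hnpos])
  · rw [lt_div_iff₀ hδ] at hsmall
    have hx : (n : ℝ) * (δ / 12) < 1 := by linarith
    have hx0 : 0 < (n : ℝ) * (δ / 12) := by positivity
    have hcn : c * n * n ^ 2 < 1 := by
      calc c * n * n ^ 2 ≤ (δ / 12) ^ 3 * n * n ^ 2 := by gcongr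
        _ = (n * (δ / 12)) ^ 3 := by ring
        _ < 1 := pow_lt_one₀ hx0.le hx (by norm_num)
    have hcn' : c * n < (1 / (n : ℝ)) ^ 2 := by
      rw [one_div, inv_pow, ← one_div, lt_div_iff₀ (by positivity)]
      exact hcn
    -- The time horizon is less than two steps, so the probability of failing to disperse in the
    -- first step, at least `1 / n ^ 2 > c * n`, is enough.
    have hfloor : ⌊Real.exp (c * n)⌋₊ ≤ 1 := by
      have h₁ : (1 / (n : ℝ)) ^ 2 ≤ 1 / 4 := by
        have : (2 : ℝ) ≤ n := by exact_mod_cast hn1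
        calc (1 / (n : ℝ)) ^ 2 ≤ (1 / 2) ^ 2 := by gcongr
          _ = _ := by norm_num
      have h₂ : Real.exp (c * n) < 2 := by
        rw [← Real.lt_log_iff_exp_lt (by norm_num)]
        linarith [Real.log_two_gt_d9]
      have := (Nat.floor_lt (Real.exp_pos (c * n)).le (n := 2)).mpr (by exact_mod_cast h₂)
      omega
    calc _ ≤ (choiceMeasure G M).real {ω | Dispersed (config o ω 1)} :=
          measureReal_mono fun ω => dispersed_config_mono o ω hfloor
      _ ≤ 1 - (1 / (n : ℝ)) ^ 2 := by
          simpa only [Fintype.card_fin] using prob_dispersed_one_le G o hM2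
      _ < 1 - c * n := by linarith
      _ ≤ _ := Real.one_sub_le_exp_neg _

end Dispersion

theorem theorem1 (δ : ℝ) (hδ : 0 < δ) :
    (∃ A B : ℝ, 0 < A ∧ 0 < B ∧
      ∀ (n : ℕ) (G : SimpleGraph (Fin n)),
        (G = ⊤ ∨ ∃ r : Fin n, G = SimpleGraph.starGraph r) →
        ∀ (M : ℕ) (o : Fin n), (M : ℝ) / n ≤ (1 / 2) * (1 - δ) →
          1 - B / n ≤ Dispersion.probDispersedWithin G M o (A * Real.log n)) ∧
    (∃ c : ℝ, 0 < c ∧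
      ∀ (n : ℕ) (G : SimpleGraph (Fin n)),
        (G = ⊤ ∨ ∃ r : Fin n, G = SimpleGraph.starGraph r) →
        ∀ (M : ℕ) (o : Fin n), (1 / 2) * (1 + δ) ≤ (M : ℝ) / n → (M : ℝ) / n < 1 →
          Dispersion.probDispersedWithin G M o (Real.exp (c * n)) < Real.exp (-(c * n))) := by
  refine ⟨⟨4 / δ, Real.exp δ, by positivity, Real.exp_pos δ, fun n G hG M o hM =>
    Dispersion.probDispersedWithin_subcritical hδ hG M o hM⟩, ?_⟩
  rcases lt_or_ge δ 1 with hδ1 | hδ1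
  · exact ⟨Dispersion.survivalRate δ, Dispersion.survivalRate_pos hδ hδ1, fun n G hG M o h₁ h₂ =>
      Dispersion.probDispersedWithin_supercritical hδ hδ1 hG M o h₁ h₂⟩
  -- For `δ ≥ 1` the density would have to be at least 1, so any constant works.
  · exact ⟨1, one_pos, fun n G hG M o h₁ h₂ => absurd h₂ (by linarith)⟩
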